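/- **Setting.** Let $N,M\ge 1$, let $\mathcal X_1,\dots,\mathcal X_N$ be nonempty sets, $\mathcal X=\prod_{i=1}^N\mathcal X_i$, let $\mathcal E_1,\dots,\mathcal E_M$ be separable real Hilbert spaces, $\mathcal E=\prod_{j=1}^M\mathcal E_j$ (product Hilbert space), and let $g_i=(g_{ij})_{j}\colon\mathcal X_i\to\mathcal E$ and $f_j\colon\mathcal E_j\to\mathbb R$. Put $f(y)=\sum_{j=1}^M f_j(y_j)$, $G(x)=\frac1N\sum_{i=1}^N g_i(x_i)$ and $J(x)=f(G(x))$ for $x\in\mathcal X$. For a finitely supported probability distribution $\mu=\sum_l p_l\delta_{a_l}$ write $E_\mu[F]=\sum_l p_lF(a_l)$, and let $$\mathcal J^*=\inf_{\mu_1,\dots,\mu_N} f\Big(\frac1N\sum_{i=1}^N E_{\mu_i}[g_i]\Big),$$ where $\mu_i$ ranges over the finitely supported probability distributions on $\mathcal X_i$. Let $S_{ij}=g_{ij}(\mathcal X_i)$, let $d_{ij}$ be the diameter of $S_{ij}$, and let $S_j=\frac1N\sum_{i=1}^N S_{ij}$ (Minkowski sum). **Assumptions.** For all $i,j$: $d_{ij}<\infty$;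 $f_j$ is $L_j$-Lipschitz on $\mathrm{conv}(S_j)$; $f_j$ is continuously differentiable on a neighborhood of $\mathrm{conv}(S_j)$, and $\nabla f_j$ is $\tilde L_j$-Lipschitz on $\mathrm{conv}(S_j)$; $f_j$ is convex and lower semicontinuous on $\mathcal E_j$. Maps $\mathbb S_i\colon\mathrm{conv}(G(\mathcal X))\to\mathcal X_i$ are given such that, for all $i$ and all $y\in\mathrm{conv}(G(\mathcal X))$, $\mathbb S_i(y)$ minimizes $x_i\mapsto\langle\nabla f(y),g_i(x_i)\rangle$ over $\mathcal X_i$. Let $$C_0=\sum_{j=1}^M L_j\max_{1\le i\le N}d_{ij},\qquad C_1=\frac1N\sum_{j=1}^M\tilde L_j\sum_{i=1}^N d_{ij}^2,$$ and assume that $C_0$ and $C_1$ are not both zero. **Stochastic Frank-Wolfe (SFW) algorithm.** Given $x^0\in\mathcal X$, step sizes $\omega_k\in[0,1]$ and integers $n_k\ge1$, for $k=0,1,2,\dots$: put $y^k=G(x^k)$ and $\bar x_i^k=\mathbb S_i(y^k)$ for $1\le i\le N$; for $j=1,\dots,n_k$ and $i=1,\dots,N$, simulate a Bernoulli random variable $\lambda_i^{k,j}$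 with parameter $\omega_k$, independently of all previously defined random variables, and set $\hat x_i^{k,j}=\bar x_i^k$ if $\lambda_i^{k,j}=1$ and $\hat x_i^{k,j}=x_i^k$ if $\lambda_i^{k,j}=0$; finally, choose $x^{k+1}$ among $\hat x^{k,1},\dots,\hat x^{k,n_k}$ with minimal value of $J$. **Statement.** Let $A>0$, and assume that $\omega_k=\frac{2}{k+2}$ and $n_k\ge\max\big(\frac{Ak^2}{N},1\big)$ for all $k\in\mathbb N$. Let $\gamma_K=J(x^K)-\mathcal J^*$. Then, for all $K=1,\dots,2N$, $$\mathbb P\Big[\gamma_K<\frac{4C_1+C_0}{K}\Big]\ge 1-\exp\Big(-\frac{A}{12}\Big).$$ -/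

import Mathlib

open MeasureTheory ProbabilityTheory Convexity
open scoped Pointwise

noncomputable section

namespace Aggregative

universe u v w

/-- Data of the aggregative problem `inf_x f (G x)`: contributions `g i j : X i → E j` of the `N`
agents, and an additive social cost `f (y) = ∑ j, f j (y j)`. -/
structure Problem {N M : ℕ} (X : Fin N → Type u) (E : Fin M → Type v) where
  g : ∀ (i : Fin N) (j : Fin M), X i → E j
  f : ∀ j : Fin M, E j → ℝ

namespace Problem

variable {N M : ℕ} {X : Fin N → Type u} {E : Fin M → Type v}
  [∀ j, NormedAddCommGroup (E j)] [∀ j, InnerProductSpace ℝ (E j)] (P : Problem X E)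

/-- The contribution `g_i(x_i) = (g_{i1}(x_i), …, g_{iM}(x_i))` of agent `i`, in the product
Hilbert space. -/
def contrib (i : Fin N) (xi : X i) : PiLp 2 E := WithLp.toLp 2 fun j => P.g i j xi

/-- The social cost `f(y) = ∑ j, f_j(y_j)`. -/
def cost (y : PiLp 2 E) : ℝ := ∑ j, P.f j (y j)

/-- The aggregate `G(x) = (1/N) ∑ i, g_i(x_i)`. -/
def G (x : ∀ i, X i) : PiLp 2 E := (1 / (N : ℝ)) • ∑ i, P.contrib i (x i)

/-- The criterion `J(x) = f(G(x))`. -/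
def J (x : ∀ i, X i) : ℝ := P.cost (P.G x)

/-- The integral `E_μ[F]` of `F` against a finitely supported probability distribution `μ`. -/
def expect {α : Type*} {H : Type*} [AddCommGroup H] [Module ℝ H]
    (μ : StdSimplex ℝ α) (F : α → H) : H :=
  μ.weights.sum fun a r => r • F a

/-- The relaxed criterion `𝓙(μ) = f((1/N) ∑ i, E_{μ_i}[g_i])`. -/
def relaxedJ (μ : ∀ i, StdSimplex ℝ (X i)) : ℝ :=
  P.cost ((1 / (N : ℝ)) • ∑ i, expect (μ i) (P.contrib i))

/-- The value `𝓙*` of the relaxed problem: the infimum of `𝓙` over all `N`-tuples of finitely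
supported probability distributions. -/
def relaxedValue : ℝ := ⨅ μ : ∀ i, StdSimplex ℝ (X i), P.relaxedJ μ

/-- The range set `S_{ij}` of `g_{ij}`. -/
def rangeSet (i : Fin N) (j : Fin M) : Set (E j) := Set.range (P.g i j)

/-- The Minkowski average `S_j = (1/N) ∑ i, S_{ij}`. -/
def avgSet (j : Fin M) : Set (E j) := (1 / (N : ℝ)) • ∑ i, P.rangeSet i j

/-- The diameter `d_{ij}` of `S_{ij}`. -/
def diam (i : Fin N) (j : Fin M) : ℝ := Metric.diam (P.rangeSet i j)

/-- `C_0 = ∑ j, L_j max_i d_{ij}`. -/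
def C0 (L : Fin M → NNReal) : ℝ := ∑ j, (L j : ℝ) * ⨆ i, P.diam i j

/-- `C_1 = (1/N) ∑ j, L̃_j ∑ i, d_{ij}^2`. -/
def C1 (Lt : Fin M → NNReal) : ℝ := (1 / (N : ℝ)) * ∑ j, (Lt j : ℝ) * ∑ i, P.diam i j ^ 2

/-- Regularity: bounded range sets, `f_j` is `L_j`-Lipschitz on `conv S_j`, and continuously
differentiable near `conv S_j` with an `L̃_j`-Lipschitz gradient on `conv S_j`. -/
structure Regular [∀ j, CompleteSpace (E j)] (L Lt : Fin M → NNReal) : Prop where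
  bounded : ∀ i j, Bornology.IsBounded (P.rangeSet i j)
  lipschitz : ∀ j, LipschitzOnWith (L j) (P.f j) (convexHull ℝ (P.avgSet j))
  contDiff : ∀ j, ∃ U : Set (E j), IsOpen U ∧ convexHull ℝ (P.avgSet j) ⊆ U ∧
    ContDiffOn ℝ 1 (P.f j) U
  lipschitz_gradient : ∀ j,
    LipschitzOnWith (Lt j) (gradient (P.f j)) (convexHull ℝ (P.avgSet j))

/-- Each `f_j` is lower semicontinuous and convex. -/
structure ConvexLSC : Prop where
  lsc : ∀ j, LowerSemicontinuous (P.f j)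
  convex : ∀ j, ConvexOn ℝ Set.univ (P.f j)

/-- `S i y` minimizes `⟨∇f(y), g_i(·)⟩` over `X i`, for all `i` and all `y ∈ conv (G(X))`; the
values of `S i` elsewhere are irrelevant. -/
def IsBestResponse [∀ j, CompleteSpace (E j)] (S : ∀ i, PiLp 2 E → X i) : Prop :=
  ∀ i, ∀ y ∈ convexHull ℝ (Set.range P.G), ∀ xi : X i,
    inner ℝ (gradient P.cost y) (P.contrib i (S i y)) ≤
      inner ℝ (gradient P.cost y) (P.contrib i xi)

section Algorithm

variable {Ω : Type w} {n : ℕ → ℕ}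

/-- The candidate `x̂^{k,j}`: coordinate `i` is `x̄_i^k = S i (G (x^k))` if `lam_i^{k,j} = 1`
(encoded as `true`) and `x_i^k` otherwise. -/
def candidate (S : ∀ i, PiLp 2 E → X i)
    (lam : ∀ k : ℕ, Fin (n k) → Fin N → Ω → Bool) (x : ℕ → Ω → ∀ i, X i)
    (k : ℕ) (j : Fin (n k)) (ω : Ω) : ∀ i, X i :=
  fun i => if lam k j i ω = true then S i (P.G (x k ω)) else x k ω i

/-- The σ-algebra generated by all random variables defined before `lam_i^{k,j}` is simulated: the
iterates `x^0, …, x^k` and the Bernoulli variables of smaller index in the lexicographic order. No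
σ-algebra is prescribed on `X i`: every subset of the product of the `X i` counts as an event. -/
abbrev past (lam : ∀ k : ℕ, Fin (n k) → Fin N → Ω → Bool) (x : ℕ → Ω → ∀ i, X i)
    (k : ℕ) (j : Fin (n k)) (i : Fin N) : MeasurableSpace Ω :=
  (⨆ (l : ℕ) (_ : l ≤ k), MeasurableSpace.comap (x l) ⊤) ⊔
  ⨆ (k' : ℕ) (j' : Fin (n k')) (i' : Fin N)
    (_ : k' < k ∨ (k' = k ∧ (j' : ℕ) < (j : ℕ)) ∨ (k' = k ∧ (j' : ℕ) = (j : ℕ) ∧ i' < i)),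
    MeasurableSpace.comap (lam k' j' i') ⊤

/-- `x` is a sequence of iterates of the stochastic Frank-Wolfe algorithm started at `x0`, with
best responses `S`, step sizes `om k`, numbers of samplings `n k` and Bernoulli variables `lam`. -/
structure IsSFW [MeasurableSpace Ω] (Pr : Measure Ω) (S : ∀ i, PiLp 2 E → X i) (x0 : ∀ i, X i)
    (om : ℕ → unitInterval) (lam : ∀ k : ℕ, Fin (n k) → Fin N → Ω → Bool)
    (x : ℕ → Ω → ∀ i, X i) : Prop where
  measurable_lam : ∀ k j i, Measurable (lam k j i)
  measurable_x : ∀ k, Measurable[_, ⊤] (x k)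
  bernoulli : ∀ k j i, HasLaw (lam k j i) (bernoulliMeasure true false (om k)) Pr
  indep : ∀ k j i, Indep (MeasurableSpace.comap (lam k j i) ⊤) (past lam x k j i) Pr
  init : ∀ ω, x 0 ω = x0
  mem_candidates : ∀ k ω, ∃ j, x (k + 1) ω = P.candidate S lam x k j ω
  argmin : ∀ k ω j, P.J (x (k + 1) ω) ≤ P.J (P.candidate S lam x k j ω)

end Algorithm

end Problem

end Aggregative

end

open MeasureTheory ProbabilityTheory Convexity
open scoped Pointwise

noncomputable section

namespace Aggregative

/-! The proof is a Chernoff bound for the weighted gap `k (k + 1) γ_k`, whose exponential moment is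
propagated from one iteration to the next.

Deterministic side. The mean of `J` over a random candidate is bounded by the descent lemma, used
twice: once around the averaged aggregate, where the first-order noise vanishes and the variance
costs `p (1 - p) C1 / (2 N)`, and once from the current aggregate to the averaged one, costing `p ^
2 C1 / 2`. By convexity the first-order term is at most `-p γ_k`, so the mean gap contracts by `1 -
p` (`Regular.bernoulliMean_J_switch_bestResponse_le`).

Random side. One agent changes `J` by at most `C0 / N`. Integrating out the Bernoulli variables one
by one gives a McDiarmid-type exponential bound (`lintegral_mul_exp_le_bernoulliMean`). The best
candidate is no worse than the average of the `n k` candidates, and averaging divides the variance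
term by `n k` (`IsSFW.lintegral_exp_succ_le`).

With `ω_k = 2 / (k + 2)` one has `(k + 1) (k + 2) (1 - ω_k) = k (k + 1)`, so the weighted moments
telescope (`IsSFW.lintegral_exp_gap_le`), and `N n_k ≥ A k ^ 2` keeps each variance increment linear
in `k`. Markov's inequality with the exponent of `exists_chernoff_exponent` concludes. -/

/-- The mean of `F` under `N` independent Bernoulli variables with parameter `p`. -/
def bernoulliMean (p : ℝ) : ∀ {N : ℕ}, ((Fin N → Bool) → ℝ) → ℝ
  | 0, F => F Fin.elim0
  | _ + 1, F => p * bernoulliMean p (fun b => F (Fin.cons true b)) +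
      (1 - p) * bernoulliMean p (fun b => F (Fin.cons false b))

/-! ### Averages over independent Bernoulli variables -/

section BernoulliMean

variable {p : ℝ} {N : ℕ}

lemma bernoulliMean_mono (h0 : 0 ≤ p) (h1 : p ≤ 1) {F F' : (Fin N → Bool) → ℝ}
    (h : ∀ b, F b ≤ F' b) : bernoulliMean p F ≤ bernoulliMean p F' := by
  induction N with
  | zero => exact h _
  | succ N ih =>
    simp only [bernoulliMean]
    have h1' : 0 ≤ 1 - p := by linarith
    gcongr
    · exact ih fun b => h _
    · exact ih fun b => h _

lemma bernoulliMean_const (c : ℝ) : bernoulliMean p (fun _ : Fin N → Bool => c) = c := by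
  induction N with
  | zero => rfl
  | succ N ih => simp only [bernoulliMean, ih]; ring

lemma bernoulliMean_add (F F' : (Fin N → Bool) → ℝ) :
    bernoulliMean p (fun b => F b + F' b) = bernoulliMean p F + bernoulliMean p F' := by
  induction N with
  | zero => rfl
  | succ N ih => simp only [bernoulliMean, ih]; ring

lemma bernoulliMean_const_mul (c : ℝ) (F : (Fin N → Bool) → ℝ) :
    bernoulliMean p (fun b => c * F b) = c * bernoulliMean p F := by
  induction N with
  | zero => rfl
  | succ N ih => simp only [bernoulliMean, ih]; ring

lemma bernoulliMean_sum {ι : Type*} (s : Finset ι) (F : ι → (Fin N → Bool) → ℝ) :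
    bernoulliMean p (fun b => ∑ j ∈ s, F j b) = ∑ j ∈ s, bernoulliMean p (F j) := by
  classical
  induction s using Finset.induction_on with
  | empty => simpa using bernoulliMean_const (p := p) (N := N) 0
  | insert a s ha ih => simp only [Finset.sum_insert ha, bernoulliMean_add, ih]

/-- Bounded differences survive averaging over the remaining coordinates; this is what allows the
variables to be integrated out one at a time. -/
lemma abs_bernoulliMean_sub_le (h0 : 0 ≤ p) (h1 : p ≤ 1) {F F' : (Fin N → Bool) → ℝ} {c : ℝ}
    (h : ∀ b, |F b - F' b| ≤ c) : |bernoulliMean p F - bernoulliMean p F'| ≤ c := by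
  have key : ∀ F F' : (Fin N → Bool) → ℝ, (∀ b, |F b - F' b| ≤ c) →
      bernoulliMean p F ≤ bernoulliMean p F' + c := by
    intro F F' h
    rw [← bernoulliMean_const (p := p) (N := N) c, ← bernoulliMean_add]
    exact bernoulliMean_mono h0 h1 fun b => by linarith [(abs_le.1 (h b)).2]
  rw [abs_le]
  constructor
  · linarith [key F' F fun b => by rw [abs_sub_comm]; exact h b]
  · linarith [key F F' h]

variable {H : Type*} [NormedAddCommGroup H] [InnerProductSpace ℝ H]

/-- The centered variable `(b - p) • v` for a Bernoulli variable `b`. -/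
def centered (p : ℝ) (b : Bool) (v : H) : H := ((if b then 1 else 0) - p) • v

lemma bernoulliMean_inner_sum_centered (u w : H) (v : Fin N → H) :
    bernoulliMean p (fun b => inner ℝ u (w + ∑ i, centered p (b i) (v i))) = inner ℝ u w := by
  induction N generalizing w with
  | zero => simp [bernoulliMean]
  | succ N ih =>
    simp only [bernoulliMean, Fin.sum_univ_succ, Fin.cons_zero, Fin.cons_succ, ← add_assoc, ih]
    simp only [centered, inner_add_right, inner_smul_right]
    simp
    ring

/-- Cross terms vanish because the summands are centered, and each has variance `p (1 - p) ‖v i‖ ^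
2`. The offset `w` absorbs the first summand in the induction. -/
lemma bernoulliMean_norm_sq_sum_centered (w : H) (v : Fin N → H) :
    bernoulliMean p (fun b => ‖w + ∑ i, centered p (b i) (v i)‖ ^ 2) =
      ‖w‖ ^ 2 + p * (1 - p) * ∑ i, ‖v i‖ ^ 2 := by
  induction N generalizing w with
  | zero => simp [bernoulliMean]
  | succ N ih =>
    simp only [bernoulliMean, Fin.sum_univ_succ, Fin.cons_zero, Fin.cons_succ, ← add_assoc, ih]
    simp only [centered, norm_add_sq_real, inner_smul_right, norm_smul, mul_pow, Real.norm_eq_abs,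
      sq_abs]
    simp
    ring

end BernoulliMean

/-- Centering at the mean and using `exp y ≤ 1 + y + y ^ 2` for `|y| ≤ 1` leaves only the variance.
The degenerate alternative `p (1 - p) = 0` needs no bound on `t`; it covers the iteration with step
size `1`. -/
lemma bernoulli_exp_le {p t a b c : ℝ} (h0 : 0 ≤ p) (h1 : p ≤ 1) (hab : |a - b| ≤ c)
    (ht : p * (1 - p) = 0 ∨ |t| * c ≤ 1) :
    p * Real.exp (t * a) + (1 - p) * Real.exp (t * b) ≤
      Real.exp (t * (p * a + (1 - p) * b) + p * (1 - p) * (t * c) ^ 2) := by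
  rcases ht with hp | ht
  · have : p = 0 ∨ p = 1 := by
      rcases mul_eq_zero.1 hp with h | h
      · exact Or.inl h
      · right; linarith
    rcases this with rfl | rfl <;> simp
  set m := p * a + (1 - p) * b with hm
  have h1' : 0 ≤ 1 - p := by linarith
  have hD : |t * (a - b)| ≤ |t| * c := by
    rw [abs_mul]; gcongr
  have hD1 : |t * (a - b)| ≤ 1 := hD.trans ht
  have hsq : (t * (a - b)) ^ 2 ≤ (t * c) ^ 2 := by
    rw [← sq_abs (t * (a - b)), mul_pow t c, ← sq_abs t, ← mul_pow]
    gcongr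
  have key : ∀ y : ℝ, |y| ≤ 1 → Real.exp y ≤ 1 + y + y ^ 2 := fun y hy => by
    linarith [(abs_le.1 (Real.abs_exp_sub_one_sub_id_le hy)).2]
  have ea : t * a = t * m + (1 - p) * (t * (a - b)) := by rw [hm]; ring
  have eb : t * b = t * m + -p * (t * (a - b)) := by rw [hm]; ring
  have ka := key ((1 - p) * (t * (a - b))) (by
    rw [abs_mul, abs_of_nonneg h1']; nlinarith [abs_nonneg (t * (a - b))])
  have kb := key (-p * (t * (a - b))) (by
    rw [abs_mul, abs_neg, abs_of_nonneg h0]; nlinarith [abs_nonneg (t * (a - b))])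
  rw [ea, eb, Real.exp_add, Real.exp_add, Real.exp_add (t * m)]
  have hfin : p * Real.exp ((1 - p) * (t * (a - b))) + (1 - p) * Real.exp (-p * (t * (a - b)))
      ≤ Real.exp (p * (1 - p) * (t * c) ^ 2) := by
    calc _ ≤ p * (1 + (1 - p) * (t * (a - b)) + ((1 - p) * (t * (a - b))) ^ 2) +
          (1 - p) * (1 + -p * (t * (a - b)) + (-p * (t * (a - b))) ^ 2) := by gcongr
      _ = p * (1 - p) * (t * (a - b)) ^ 2 + 1 := by ring
      _ ≤ p * (1 - p) * (t * c) ^ 2 + 1 := by gcongr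
      _ ≤ _ := Real.add_one_le_exp _
  calc _ = Real.exp (t * m) * (p * Real.exp ((1 - p) * (t * (a - b))) +
        (1 - p) * Real.exp (-p * (t * (a - b)))) := by ring
    _ ≤ _ := by gcongr

/-! ### First-order inequalities: convexity and the descent lemma -/

section Gradient

variable {H : Type*} [NormedAddCommGroup H] [InnerProductSpace ℝ H] [CompleteSpace H]

lemma hasDerivAt_comp_lineMap_of_differentiableAt {f : H → ℝ} {a v : H} {t : ℝ}
    (h : DifferentiableAt ℝ f (a + t • v)) :
    HasDerivAt (fun s : ℝ => f (a + s • v)) (inner ℝ (gradient f (a + t • v)) v) t := by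
  have hl : HasDerivAt (fun s : ℝ => a + s • v) v t := by
    simpa using ((hasDerivAt_id t).smul_const v).const_add a
  rw [inner_gradient_left]
  exact h.hasFDerivAt.comp_hasDerivAt t hl

lemma add_inner_gradient_le_of_convexOn {f : H → ℝ} (hf : ConvexOn ℝ Set.univ f) {a : H}
    (h : DifferentiableAt ℝ f a) (b : H) : f a + inner ℝ (gradient f a) (b - a) ≤ f b := by
  have hd := hasDerivAt_comp_lineMap_of_differentiableAt (f := f) (a := a) (v := b - a) (t := 0)
    (by simpa using h)
  have hc : ConvexOn ℝ Set.univ (fun s : ℝ => f (a + s • (b - a))) := by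
    have := hf.comp_affineMap (AffineMap.lineMap a b : ℝ →ᵃ[ℝ] H)
    refine this.congr fun s _ => ?_
    simp [AffineMap.lineMap_apply, add_comm]
  have := hc.le_slope_of_hasDerivAt (Set.mem_univ 0) (Set.mem_univ 1) zero_lt_one hd
  rw [slope_def_field] at this
  simp only [zero_smul, add_zero, one_smul, add_sub_cancel, sub_zero, div_one] at this
  linarith

/-- Descent lemma: along the segment, the derivative exceeds its initial value by at most `K ‖b - a‖
^ 2 t`, so a quadratic in `t` with the same value at `0` dominates. -/
lemma le_add_inner_gradient_add_of_lipschitzOnWith {f : H → ℝ} {C : Set H} (hC : Convex ℝ C)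
    (hd : ∀ y ∈ C, DifferentiableAt ℝ f y) {K : NNReal} (hL : LipschitzOnWith K (gradient f) C)
    {a b : H} (ha : a ∈ C) (hb : b ∈ C) :
    f b ≤ f a + inner ℝ (gradient f a) (b - a) + K / 2 * ‖b - a‖ ^ 2 := by
  have hmem : ∀ t ∈ Set.Icc (0 : ℝ) 1, a + t • (b - a) ∈ C := fun t ht =>
    hC.add_smul_sub_mem ha hb ht
  have hder : ∀ t ∈ Set.Icc (0 : ℝ) 1, HasDerivAt (fun s : ℝ => f (a + s • (b - a)))
      (inner ℝ (gradient f (a + t • (b - a))) (b - a)) t := fun t ht =>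
    hasDerivAt_comp_lineMap_of_differentiableAt (hd _ (hmem t ht))
  have hB : ∀ t : ℝ, HasDerivAt
      (fun t : ℝ => f a + t * inner ℝ (gradient f a) (b - a) + K / 2 * ‖b - a‖ ^ 2 * t ^ 2)
      (inner ℝ (gradient f a) (b - a) + K * ‖b - a‖ ^ 2 * t) t := by
    intro t
    refine ((((hasDerivAt_id t).mul_const _).const_add _).add
      ((hasDerivAt_pow 2 t).const_mul _)).congr_deriv ?_
    simp; ring
  have := image_le_of_deriv_right_le_deriv_boundary
    (fun t ht => (hder t ht).continuousAt.continuousWithinAt)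
    (fun t ht => (hder t (Set.Ico_subset_Icc_self ht)).hasDerivWithinAt)
    (by simp) (fun t _ => (hB t).continuousAt.continuousWithinAt)
    (fun t _ => (hB t).hasDerivWithinAt) ?_ (Set.right_mem_Icc.2 zero_le_one)
  · simpa using this
  · intro t ht
    have h1 : inner ℝ (gradient f (a + t • (b - a)) - gradient f a) (b - a) ≤
        ‖gradient f (a + t • (b - a)) - gradient f a‖ * ‖b - a‖ := real_inner_le_norm _ _
    have h2 := hL.norm_sub_le (hmem t (Set.Ico_subset_Icc_self ht)) ha
    rw [add_sub_cancel_left, norm_smul, Real.norm_of_nonneg ht.1] at h2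
    rw [inner_sub_left] at h1
    nlinarith [norm_nonneg (b - a)]

end Gradient

/-! ### Integrating out Bernoulli variables independent of the past -/

section Peeling

variable {Ω : Type*} {m mΩ : MeasurableSpace Ω} {μ : Measure Ω} {p : unitInterval}

/-- Independence factors the integral over each of the events `l = true` and `l = false`. Working in
`ENNReal` avoids integrability conditions and conditional expectations. -/
lemma lintegral_bool_ite_eq (hm : m ≤ mΩ) {l : Ω → Bool} (hl : Measurable l)
    (hlaw : HasLaw l (bernoulliMeasure true false p) μ)
    (hind : Indep (MeasurableSpace.comap l ⊤) m μ) {V W : Ω → ENNReal}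
    (hV : Measurable[m] V) (hW : Measurable[m] W) :
    ∫⁻ ω, (if l ω then V ω else W ω) ∂μ =
      ∫⁻ ω, ENNReal.ofReal p * V ω + ENNReal.ofReal (1 - p) * W ω ∂μ := by
  have hlm : MeasurableSpace.comap l ⊤ ≤ mΩ := by
    rw [← measurable_iff_comap_le]; exact hl
  have hV' := hV.mono hm le_rfl
  have hW' := hW.mono hm le_rfl
  have key : ∀ (c : Bool) (q : ENNReal) (V : Ω → ENNReal), Measurable[m] V →
      bernoulliMeasure true false p {c} = q →
      ∫⁻ ω, V ω * (if l ω = c then 1 else 0) ∂μ = q * ∫⁻ ω, V ω ∂μ := by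
    intro c q V hV hq
    rw [lintegral_mul_eq_lintegral_mul_lintegral_of_independent_measurableSpace hm hlm hind.symm hV
      (g := fun ω => if l ω = c then 1 else 0)
      ((measurable_of_finite (fun d : Bool => if d = c then (1 : ENNReal) else 0)).comp
        (comap_measurable l)), mul_comm]
    congr 1
    rw [← hq, ← hlaw.map_eq, Measure.map_apply hl (measurableSet_singleton c),
      ← lintegral_indicator_one (hl (measurableSet_singleton c))]
    congr 1 with ω
    by_cases h : l ω = c <;> simp [h]
  have ht : bernoulliMeasure true false p {true} = ENNReal.ofReal p := by
    rw [bernoulliMeasure_apply_of_mem_of_notMem (p := p) (by simp) (by simp) (by simp)]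
    rw [ENNReal.ofReal]; congr 1
    ext; simp [p.2.1]
  have hf : bernoulliMeasure true false p {false} = ENNReal.ofReal (1 - p) := by
    rw [bernoulliMeasure_apply_of_notMem_of_mem (p := p) (by simp) (by simp) (by simp)]
    rw [ENNReal.ofReal]; congr 1
    ext
    rw [Real.coe_toNNReal _ (by linarith [p.2.2])]
    simp
  rw [lintegral_add_left (hV'.const_mul _), lintegral_const_mul _ hV', lintegral_const_mul _ hW',
    ← key true _ V hV ht, ← key false _ W hW hf, ← lintegral_add_left]
  · congr 1 with ω
    cases l ω <;> simp
  · exact hV'.mul ((measurable_of_finite (fun d : Bool => if d = true then (1 : ENNReal) else 0)).comp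
        hl)

lemma lintegral_mul_exp_bool_ite_le (hm : m ≤ mΩ) {l : Ω → Bool} (hl : Measurable l)
    (hlaw : HasLaw l (bernoulliMeasure true false p) μ)
    (hind : Indep (MeasurableSpace.comap l ⊤) m μ) {U : Ω → ENNReal} {a b : Ω → ℝ}
    (hU : Measurable[m] U) (ha : Measurable[m] a) (hb : Measurable[m] b) {t c : ℝ}
    (hab : ∀ ω, |a ω - b ω| ≤ c) (ht : (p : ℝ) * (1 - p) = 0 ∨ |t| * c ≤ 1) :
    ∫⁻ ω, U ω * ENNReal.ofReal (Real.exp (t * if l ω then a ω else b ω)) ∂μ ≤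
      ∫⁻ ω, U ω * ENNReal.ofReal (Real.exp (t * (p * a ω + (1 - p) * b ω) +
        p * (1 - p) * (t * c) ^ 2)) ∂μ := by
  have h0 : (0 : ℝ) ≤ p := p.2.1
  have h1 : (0 : ℝ) ≤ 1 - p := by linarith [p.2.2]
  have hexp : ∀ a : Ω → ℝ, Measurable[m] a →
      Measurable[m] fun ω => U ω * ENNReal.ofReal (Real.exp (t * a ω)) := fun a ha =>
    hU.mul (Measurable.ennreal_ofReal (Real.measurable_exp.comp (ha.const_mul t)))
  calc _ = ∫⁻ ω, (if l ω then U ω * ENNReal.ofReal (Real.exp (t * a ω)) else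
        U ω * ENNReal.ofReal (Real.exp (t * b ω))) ∂μ := by
        congr 1 with ω
        split_ifs <;> rfl
    _ = _ := lintegral_bool_ite_eq hm hl hlaw hind (hexp a ha) (hexp b hb)
    _ ≤ _ := by
      refine lintegral_mono fun ω => ?_
      have := bernoulli_exp_le h0 (by linarith) (hab ω) ht
      calc _ = U ω * (ENNReal.ofReal p * ENNReal.ofReal (Real.exp (t * a ω)) +
            ENNReal.ofReal (1 - p) * ENNReal.ofReal (Real.exp (t * b ω))) := by ring
        _ = U ω * ENNReal.ofReal (p * Real.exp (t * a ω) + (1 - p) * Real.exp (t * b ω)) := by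
          rw [ENNReal.ofReal_add (by positivity) (by positivity), ENNReal.ofReal_mul h0,
            ENNReal.ofReal_mul h1]
        _ ≤ _ := by gcongr

lemma measurable_bernoulliMean {q : ℝ} {N : ℕ} {F : Ω → (Fin N → Bool) → ℝ}
    (hF : ∀ b, Measurable[m] fun ω => F ω b) :
    Measurable[m] fun ω => bernoulliMean q (F ω) := by
  induction N with
  | zero => exact hF _
  | succ N ih =>
    simp only [bernoulliMean]
    exact ((ih fun b => hF _).const_mul _).add ((ih fun b => hF _).const_mul _)

/-- Exponential McDiarmid inequality for Bernoulli variables that are simulated one after the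
other, each independently of the past. -/
lemma lintegral_mul_exp_le_bernoulliMean {N : ℕ} (𝓕 : ℕ → MeasurableSpace Ω) (h𝓕 : ∀ i, 𝓕 i ≤ mΩ)
    (hmono : Monotone 𝓕) {l : Fin N → Ω → Bool}
    (hl : ∀ i : Fin N, Measurable[𝓕 (i + 1)] (l i))
    (hlaw : ∀ i, HasLaw (l i) (bernoulliMeasure true false p) μ)
    (hind : ∀ i : Fin N, Indep (MeasurableSpace.comap (l i) ⊤) (𝓕 i) μ) {U : Ω → ENNReal}
    {F : Ω → (Fin N → Bool) → ℝ} (hU : Measurable[𝓕 0] U)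
    (hF : ∀ b, Measurable[𝓕 0] fun ω => F ω b) {t c : ℝ}
    (hc : ∀ ω i b b', (∀ i' ≠ i, b i' = b' i') → |F ω b - F ω b'| ≤ c)
    (ht : (p : ℝ) * (1 - p) = 0 ∨ |t| * c ≤ 1) :
    ∫⁻ ω, U ω * ENNReal.ofReal (Real.exp (t * F ω fun i => l i ω)) ∂μ ≤
      ∫⁻ ω, U ω * ENNReal.ofReal (Real.exp (t * bernoulliMean p (F ω) +
        N * (p * (1 - p) * (t * c) ^ 2))) ∂μ := by
  induction N generalizing 𝓕 U with
  | zero =>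
    refine le_of_eq ?_
    congr 1 with ω
    simp [bernoulliMean, Subsingleton.elim (fun i => l i ω) Fin.elim0]
  | succ N ih =>
    set v : ℝ := p * (1 - p) * (t * c) ^ 2 with hv
    have h0 : (0 : ℝ) ≤ p := p.2.1
    have hl0 : Measurable[𝓕 1] (l 0) := hl 0
    have hcons : ∀ b : Fin N → Bool, Measurable[𝓕 1] fun ω => F ω (Fin.cons (l 0 ω) b) := by
      intro b
      have : (fun ω => F ω (Fin.cons (l 0 ω) b)) = fun ω =>
          if l 0 ω = true then F ω (Fin.cons true b) else F ω (Fin.cons false b) := by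
        ext ω
        cases l 0 ω <;> rfl
      rw [this]
      exact Measurable.ite (hl0 (measurableSet_singleton true))
        ((hF _).mono (hmono zero_le_one) le_rfl) ((hF _).mono (hmono zero_le_one) le_rfl)
    -- The variable `l 0` is frozen into the integrand, which is then known at time `1`; the later
    -- variables are integrated out along the shifted filtration.
    have step := ih (fun i => 𝓕 (i + 1)) (fun i => h𝓕 _) (fun i j h => hmono (by gcongr))
      (l := fun i => l i.succ) (fun i => by simpa using hl i.succ) (fun i => hlaw _)
      (fun i => by simpa using hind i.succ) (U := U)
      (F := fun ω b => F ω (Fin.cons (l 0 ω) b)) (hU.mono (hmono zero_le_one) le_rfl) hcons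
      (fun ω i b b' h => hc ω i.succ _ _ fun i' hi' => by
        cases i' using Fin.cases with
        | zero => simp
        | succ i' => simpa using h i' fun e => hi' (by rw [e]))
    have e1 : ∀ ω, (Fin.cons (l 0 ω) (fun i : Fin N => l i.succ ω) : Fin (N + 1) → Bool) =
        fun i => l i ω := by
      intro ω
      ext i
      cases i using Fin.cases <;> rfl
    simp only [e1] at step
    refine step.trans ?_
    have hmean : ∀ d : Bool, Measurable[𝓕 0] fun ω =>
        bernoulliMean p (fun b : Fin N → Bool => F ω (Fin.cons d b)) := fun d =>
      measurable_bernoulliMean fun b => hF _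
    -- Only `l 0` remains, choosing between two partial means that differ by at most `c`. The
    -- constant already accumulated is carried in the weight.
    have last := lintegral_mul_exp_bool_ite_le (μ := μ) (p := p) (h𝓕 0) ((hl 0).mono (h𝓕 _) le_rfl)
      (hlaw 0) (hind 0) (U := fun ω => U ω * ENNReal.ofReal (Real.exp (N * v)))
      (hU.mul_const _) (hmean true) (hmean false) (t := t) (c := c)
      (fun ω => abs_bernoulliMean_sub_le h0 p.2.2 fun b => hc ω 0 _ _ fun i' hi' => by
        cases i' using Fin.cases with
        | zero => exact absurd rfl hi'
        | succ i' => simp) ht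
    calc _ = _ := ?_
      _ ≤ _ := last
      _ = _ := ?_
    · congr 1 with ω
      rw [mul_assoc, ← ENNReal.ofReal_mul (Real.exp_pos _).le, ← Real.exp_add, add_comm]
      cases l 0 ω <;> rfl
    · congr 1 with ω
      rw [mul_assoc, ← ENNReal.ofReal_mul (Real.exp_pos _).le, ← Real.exp_add]
      simp only [bernoulliMean]
      congr 3
      push_cast
      ring

end Peeling

/-! ### Deterministic estimates for the aggregative problem -/

namespace Problem

universe u v

variable {N M : ℕ} {X : Fin N → Type u} {E : Fin M → Type v}
  [∀ j, NormedAddCommGroup (E j)] [∀ j, InnerProductSpace ℝ (E j)] {P : Problem X E}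

/-- The profile in which the agents selected by `b` switch from `x` to `x'`. -/
def switch (x x' : ∀ i, X i) (b : Fin N → Bool) : ∀ i, X i := fun i => if b i then x' i else x i

lemma G_apply (x : ∀ i, X i) (j : Fin M) :
    P.G x j = (1 / (N : ℝ)) • ∑ i, P.g i j (x i) := by
  simp [G, contrib]

lemma G_apply_mem_avgSet (x : ∀ i, X i) (j : Fin M) : P.G x j ∈ P.avgSet j := by
  rw [G_apply]
  exact Set.smul_mem_smul_set (Set.finsetSum_mem_finsetSum _ _ _ fun i _ => ⟨x i, rfl⟩)

lemma G_apply_mem_convexHull (x : ∀ i, X i) (j : Fin M) :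
    P.G x j ∈ convexHull ℝ (P.avgSet j) :=
  subset_convexHull ℝ _ (G_apply_mem_avgSet x j)

lemma inner_gradient_cost [∀ j, CompleteSpace (E j)] {y : PiLp 2 E}
    (h : ∀ j, DifferentiableAt ℝ (P.f j) (y j)) (w : PiLp 2 E) :
    inner ℝ (gradient P.cost y) w = ∑ j, inner ℝ (gradient (P.f j) (y j)) (w j) := by
  have hd : HasFDerivAt P.cost
      (∑ j, (fderiv ℝ (P.f j) (y j)).comp (PiLp.proj 2 E j : PiLp 2 E →L[ℝ] E j)) y := by
    unfold cost
    exact HasFDerivAt.fun_sum fun j _ =>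
      (h j).hasFDerivAt.comp y (PiLp.hasFDerivAt_apply 2 y j)
  rw [inner_gradient_left, hd.fderiv]
  simp [inner_gradient_left]

lemma Regular.differentiableAt [∀ j, CompleteSpace (E j)] {L Lt : Fin M → NNReal}
    (h : P.Regular L Lt) {j : Fin M} {y : E j} (hy : y ∈ convexHull ℝ (P.avgSet j)) :
    DifferentiableAt ℝ (P.f j) y := by
  obtain ⟨U, hU, hsub, hf⟩ := h.contDiff j
  exact (hf.contDiffAt (hU.mem_nhds (hsub hy))).differentiableAt one_ne_zero

lemma Regular.norm_sub_le_diam [∀ j, CompleteSpace (E j)] {L Lt : Fin M → NNReal}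
    (h : P.Regular L Lt) (i : Fin N) (j : Fin M) (a b : X i) :
    ‖P.g i j a - P.g i j b‖ ≤ P.diam i j := by
  rw [← dist_eq_norm]
  exact Metric.dist_le_diam_of_mem (h.bounded i j) ⟨a, rfl⟩ ⟨b, rfl⟩

omit [∀ j, InnerProductSpace ℝ (E j)] in
lemma diam_nonneg (i : Fin N) (j : Fin M) : 0 ≤ P.diam i j := Metric.diam_nonneg

omit [∀ j, InnerProductSpace ℝ (E j)] in
lemma C0_nonneg (L : Fin M → NNReal) : 0 ≤ P.C0 L :=
  Finset.sum_nonneg fun j _ => mul_nonneg (L j).2 (Real.iSup_nonneg fun i => diam_nonneg i j)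

omit [∀ j, InnerProductSpace ℝ (E j)] in
lemma C1_nonneg (Lt : Fin M → NNReal) : 0 ≤ P.C1 Lt :=
  mul_nonneg (by positivity) (Finset.sum_nonneg fun j _ => mul_nonneg (Lt j).2
    (Finset.sum_nonneg fun i _ => sq_nonneg _))

/-- One agent moves the `j`-th aggregate by at most `diam i j / N`; the Lipschitz constants turn
this into the bounded-difference constant. -/
lemma Regular.abs_J_sub_le [∀ j, CompleteSpace (E j)] {L Lt : Fin M → NNReal}
    (h : P.Regular L Lt) {x x' : ∀ i, X i} (i : Fin N) (hxx : ∀ i' ≠ i, x i' = x' i') :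
    |P.J x - P.J x'| ≤ P.C0 L / N := by
  have hG : ∀ j, P.G x j - P.G x' j = (1 / (N : ℝ)) • (P.g i j (x i) - P.g i j (x' i)) := by
    intro j
    rw [G_apply, G_apply, ← smul_sub, ← Finset.sum_sub_distrib]
    congr 1
    exact Finset.sum_eq_single i (fun i' _ hi' => by rw [hxx i' hi', sub_self]) (by simp)
  calc |P.J x - P.J x'| = |∑ j, (P.f j (P.G x j) - P.f j (P.G x' j))| := by
        simp [J, cost]
    _ ≤ ∑ j, |P.f j (P.G x j) - P.f j (P.G x' j)| := Finset.abs_sum_le_sum_abs _ _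
    _ ≤ ∑ j, ((L j : ℝ) * ⨆ i, P.diam i j) / N := by
      refine Finset.sum_le_sum fun j _ => ?_
      have h1 := (h.lipschitz j).norm_sub_le (G_apply_mem_convexHull x j)
        (G_apply_mem_convexHull x' j)
      rw [hG, norm_smul, Real.norm_of_nonneg (show (0 : ℝ) ≤ 1 / N by positivity),
        Real.norm_eq_abs] at h1
      refine h1.trans ?_
      have h2 : ‖P.g i j (x i) - P.g i j (x' i)‖ ≤ ⨆ i, P.diam i j :=
        (h.norm_sub_le_diam i j _ _).trans 
          (le_ciSup (f := fun i => P.diam i j) (Set.finite_range _).bddAbove i)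
      calc _ = (L j : ℝ) * ‖P.g i j (x i) - P.g i j (x' i)‖ / N := by ring
        _ ≤ _ := by gcongr
    _ = _ := by rw [C0, Finset.sum_div]

lemma le_inner_expect {α H : Type*} [NormedAddCommGroup H] [InnerProductSpace ℝ H]
    (μ : StdSimplex ℝ α) (F : α → H) (u : H) {c : ℝ} (h : ∀ a, c ≤ inner ℝ u (F a)) :
    c ≤ inner ℝ u (expect μ F) := by
  have h1 : inner ℝ u (expect μ F) = μ.weights.sum fun a r => r * inner ℝ u (F a) := by
    simp [expect, Finsupp.sum, inner_sum, inner_smul_right]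
  rw [h1]
  calc c = μ.weights.sum fun _ r => r * c := by
        have := μ.total
        rw [Finsupp.sum] at this ⊢
        rw [← Finset.sum_mul, this, one_mul]
    _ ≤ _ := Finset.sum_le_sum fun a _ =>
        mul_le_mul_of_nonneg_left (h a) (StdSimplex.weights_nonneg a)

variable [∀ j, CompleteSpace (E j)] {L Lt : Fin M → NNReal} {S : ∀ i, PiLp 2 E → X i}

/-- The Frank-Wolfe gap bounds the relaxed optimality gap. -/
lemma Regular.inner_gradient_le_relaxedValue_sub (h : P.Regular L Lt) (hconv : P.ConvexLSC)
    (hS : P.IsBestResponse S) (x : ∀ i, X i) :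
    ∑ j, inner ℝ (gradient (P.f j) (P.G x j)) (P.G (fun i => S i (P.G x)) j - P.G x j) ≤
      P.relaxedValue - P.J x := by
  have hd : ∀ j, DifferentiableAt ℝ (P.f j) (P.G x j) := fun j =>
    h.differentiableAt (G_apply_mem_convexHull x j)
  have hsum : ∀ z : PiLp 2 E, ∑ j, inner ℝ (gradient (P.f j) (P.G x j)) (z j - P.G x j) =
      inner ℝ (gradient P.cost (P.G x)) z - inner ℝ (gradient P.cost (P.G x)) (P.G x) := by
    intro z
    rw [inner_gradient_cost hd, inner_gradient_cost hd, ← Finset.sum_sub_distrib]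
    exact Finset.sum_congr rfl fun j _ => inner_sub_right _ _ _
  rw [le_sub_iff_add_le]
  have : ∀ i, Nonempty (StdSimplex ℝ (X i)) := fun i => ⟨StdSimplex.single (x i)⟩
  -- It suffices to compare with each relaxed profile: convexity linearizes the cost at `G x`, and
  -- best responses minimize the linearization agent by agent, hence also against every mixture.
  refine le_ciInf fun μ => ?_
  set z : PiLp 2 E := (1 / (N : ℝ)) • ∑ i, expect (μ i) (P.contrib i) with hz
  have hcost : P.J x + ∑ j, inner ℝ (gradient (P.f j) (P.G x j)) (z j - P.G x j) ≤
      P.relaxedJ μ := by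
    rw [J, cost, relaxedJ, cost, ← Finset.sum_add_distrib]
    exact Finset.sum_le_sum fun j _ =>
      add_inner_gradient_le_of_convexOn (hconv.convex j) (hd j) (z j)
  refine le_trans ?_ hcost
  rw [hsum, hsum, add_comm]
  gcongr
  have hG : P.G (fun i => S i (P.G x)) =
      (1 / (N : ℝ)) • ∑ i, P.contrib i (S i (P.G x)) := rfl
  rw [hz, hG, inner_smul_right, inner_smul_right, inner_sum, inner_sum]
  gcongr with i
  exact le_inner_expect _ _ _ fun a => hS i _ (subset_convexHull ℝ _ ⟨x, rfl⟩) a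

omit [∀ j, CompleteSpace (E j)] in
-- Separates the aggregate of a random candidate into its mean and a sum of independent centered
-- terms of order `1 / N`.
lemma G_switch_apply (p : ℝ) (x x' : ∀ i, X i) (b : Fin N → Bool) (j : Fin M) :
    P.G (switch x x' b) j = (P.G x j + p • (P.G x' j - P.G x j)) +
      ∑ i, centered p (b i) ((1 / (N : ℝ)) • (P.g i j (x' i) - P.g i j (x i))) := by
  simp only [G_apply, ← smul_sub, ← Finset.sum_sub_distrib, Finset.smul_sum, smul_smul, centered,
    ← Finset.sum_add_distrib]
  refine Finset.sum_congr rfl fun i _ => ?_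
  unfold switch
  cases b i
  · simp
  · simp only [if_true]
    module

lemma Regular.sum_norm_G_sub_sq_le (h : P.Regular L Lt) (x x' : ∀ i, X i) :
    ∑ j, (Lt j : ℝ) * ‖P.G x' j - P.G x j‖ ^ 2 ≤ P.C1 Lt := by
  rw [C1, Finset.mul_sum]
  refine Finset.sum_le_sum fun j _ => ?_
  have hn : ‖P.G x' j - P.G x j‖ ≤ 1 / (N : ℝ) * ∑ i, P.diam i j := by
    rw [G_apply, G_apply, ← smul_sub, ← Finset.sum_sub_distrib, norm_smul,
      Real.norm_of_nonneg (by positivity)]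
    gcongr
    exact (norm_sum_le _ _).trans (Finset.sum_le_sum fun i _ => h.norm_sub_le_diam i j _ _)
  have hcs : (∑ i, P.diam i j) ^ 2 ≤ N * ∑ i, P.diam i j ^ 2 := by
    simpa using sq_sum_le_card_mul_sum_sq (s := Finset.univ) (f := fun i => P.diam i j)
  -- This also holds for `N = 0`, since division by zero gives zero.
  have hN : (1 / (N : ℝ)) ^ 2 * N = 1 / N := by
    rcases eq_or_ne (N : ℝ) 0 with h | h
    · simp [h]
    · field_simp
  calc (Lt j : ℝ) * ‖P.G x' j - P.G x j‖ ^ 2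
      ≤ Lt j * (1 / (N : ℝ) * ∑ i, P.diam i j) ^ 2 := by gcongr
    _ = Lt j * ((1 / (N : ℝ)) ^ 2 * (∑ i, P.diam i j) ^ 2) := by ring
    _ ≤ Lt j * ((1 / (N : ℝ)) ^ 2 * (N * ∑ i, P.diam i j ^ 2)) := by gcongr
    _ = Lt j * ((1 / (N : ℝ)) ^ 2 * N * ∑ i, P.diam i j ^ 2) := by ring
    _ = _ := by rw [hN]; ring

/-- In `step1` the descent lemma is applied at the mean aggregate `m`, so the linear term averages
to zero; in `step2` it is applied from `G x` to `m`; `step3` bounds the variance by the diameters.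
-/
lemma Regular.bernoulliMean_J_switch_le (h : P.Regular L Lt) {p : ℝ} (h0 : 0 ≤ p) (h1 : p ≤ 1)
    (x x' : ∀ i, X i) :
    bernoulliMean p (fun b => P.J (switch x x' b)) ≤
      P.J x + p * ∑ j, inner ℝ (gradient (P.f j) (P.G x j)) (P.G x' j - P.G x j) +
        p ^ 2 * P.C1 Lt / 2 + p * (1 - p) * P.C1 Lt / (2 * N) := by
  set m : ∀ j, E j := fun j => P.G x j + p • (P.G x' j - P.G x j) with hm
  set w : ∀ j, Fin N → E j := fun j i =>
    (1 / (N : ℝ)) • (P.g i j (x' i) - P.g i j (x i)) with hw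
  have hmC : ∀ j, m j ∈ convexHull ℝ (P.avgSet j) := fun j =>
    (convex_convexHull ℝ _).add_smul_sub_mem (G_apply_mem_convexHull x j)
      (G_apply_mem_convexHull x' j) ⟨h0, h1⟩
  have hdesc : ∀ j, ∀ a ∈ convexHull ℝ (P.avgSet j), ∀ b ∈ convexHull ℝ (P.avgSet j),
      P.f j b ≤ P.f j a + inner ℝ (gradient (P.f j) a) (b - a) + Lt j / 2 * ‖b - a‖ ^ 2 :=
    fun j a ha b hb => le_add_inner_gradient_add_of_lipschitzOnWith (convex_convexHull ℝ _)
      (fun y hy => h.differentiableAt hy) (h.lipschitz_gradient j) ha hb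
  have hp : 0 ≤ p * (1 - p) := mul_nonneg h0 (by linarith)
  have step1 : bernoulliMean p (fun b => P.J (switch x x' b)) ≤
      ∑ j, (P.f j (m j) + Lt j / 2 * (p * (1 - p) * ∑ i, ‖w j i‖ ^ 2)) := by
    calc _ ≤ bernoulliMean p (fun b => ∑ j, (P.f j (m j) +
          inner ℝ (gradient (P.f j) (m j)) (0 + ∑ i, centered p (b i) (w j i)) +
          Lt j / 2 * ‖0 + ∑ i, centered p (b i) (w j i)‖ ^ 2)) := by
          refine bernoulliMean_mono h0 h1 fun b => ?_
          rw [J, cost]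
          refine Finset.sum_le_sum fun j _ => ?_
          have := hdesc j (m j) (hmC j) _ (G_apply_mem_convexHull (switch x x' b) j)
          rw [G_switch_apply p, add_sub_cancel_left, ← G_switch_apply p] at this
          rwa [zero_add]
      _ = _ := by
          rw [bernoulliMean_sum]
          refine Finset.sum_congr rfl fun j _ => ?_
          rw [bernoulliMean_add, bernoulliMean_add, bernoulliMean_const, bernoulliMean_const_mul,
            bernoulliMean_inner_sum_centered, bernoulliMean_norm_sq_sum_centered]
          simp
  have step2 : ∑ j, P.f j (m j) ≤
      P.J x + p * ∑ j, inner ℝ (gradient (P.f j) (P.G x j)) (P.G x' j - P.G x j) +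
        p ^ 2 * P.C1 Lt / 2 := by
    have := h.sum_norm_G_sub_sq_le x x'
    calc _ ≤ ∑ j, (P.f j (P.G x j) +
          p * inner ℝ (gradient (P.f j) (P.G x j)) (P.G x' j - P.G x j) +
          p ^ 2 / 2 * (Lt j * ‖P.G x' j - P.G x j‖ ^ 2)) := by
          refine Finset.sum_le_sum fun j _ => ?_
          have := hdesc j _ (G_apply_mem_convexHull x j) (m j) (hmC j)
          simp only [hm, add_sub_cancel_left, inner_smul_right, norm_smul, mul_pow,
            Real.norm_eq_abs, sq_abs] at this ⊢
          linarith
      _ = P.J x + p * ∑ j, inner ℝ (gradient (P.f j) (P.G x j)) (P.G x' j - P.G x j) +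
          p ^ 2 / 2 * ∑ j, Lt j * ‖P.G x' j - P.G x j‖ ^ 2 := by
          rw [Finset.sum_add_distrib, Finset.sum_add_distrib, Finset.mul_sum, Finset.mul_sum]
          rfl
      _ ≤ P.J x + p * ∑ j, inner ℝ (gradient (P.f j) (P.G x j)) (P.G x' j - P.G x j) +
          p ^ 2 / 2 * P.C1 Lt := by gcongr
      _ = _ := by ring
  have step3 : ∑ j, (Lt j : ℝ) / 2 * (p * (1 - p) * ∑ i, ‖w j i‖ ^ 2) ≤
      p * (1 - p) * P.C1 Lt / (2 * N) := by
    calc _ ≤ ∑ j, (Lt j : ℝ) / 2 * (p * (1 - p) * ∑ i, (1 / (N : ℝ) * P.diam i j) ^ 2) := by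
          gcongr with j _ i _
          rw [hw, norm_smul, Real.norm_of_nonneg (by positivity)]
          gcongr
          exact h.norm_sub_le_diam i j _ _
      _ = _ := by
          simp only [C1, mul_pow, ← Finset.mul_sum]
          simp only [mul_div_assoc, mul_assoc, Finset.mul_sum, Finset.sum_div]
          refine Finset.sum_congr rfl fun j _ => Finset.sum_congr rfl fun i _ => ?_
          ring
  rw [Finset.sum_add_distrib] at step1
  linarith

lemma Regular.bernoulliMean_J_switch_bestResponse_le (h : P.Regular L Lt) (hconv : P.ConvexLSC)
    (hS : P.IsBestResponse S) {p : ℝ} (h0 : 0 ≤ p) (h1 : p ≤ 1) (x : ∀ i, X i) :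
    bernoulliMean p (fun b => P.J (switch x (fun i => S i (P.G x)) b)) - P.relaxedValue ≤
      (1 - p) * (P.J x - P.relaxedValue) + p ^ 2 * P.C1 Lt / 2 +
        p * (1 - p) * P.C1 Lt / (2 * N) := by
  have h2 := h.bernoulliMean_J_switch_le h0 h1 x (fun i => S i (P.G x))
  have h3 := mul_le_mul_of_nonneg_left (h.inner_gradient_le_relaxedValue_sub hconv hS x) h0
  linarith

end Problem

/-! ### Histories of the algorithm and exponential moments of one iteration -/

namespace Problem

universe u v w

lemma measurable_eval_bool {Ω : Type*} {m : MeasurableSpace Ω} {N : ℕ} {l : Fin N → Ω → Bool}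
    (hl : ∀ i, Measurable (l i)) {F : Ω → (Fin N → Bool) → ℝ}
    (hF : ∀ b, Measurable fun ω => F ω b) : Measurable fun ω => F ω fun i => l i ω :=
  (measurable_from_prod_countable_left (f := fun q : Ω × (Fin N → Bool) => F q.1 q.2) hF).comp
    (measurable_id.prodMk (measurable_pi_lambda _ hl))

section History

variable {N : ℕ} {X : Fin N → Type u} {Ω : Type w} {n : ℕ → ℕ}
  (lam : ∀ k : ℕ, Fin (n k) → Fin N → Ω → Bool) (x : ℕ → Ω → ∀ i, X i)

/-- The σ-algebra `past`, indexed by natural numbers. -/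
abbrev history (k j i : ℕ) : MeasurableSpace Ω :=
  (⨆ (l : ℕ) (_ : l ≤ k), MeasurableSpace.comap (x l) ⊤) ⊔
  ⨆ (k' : ℕ) (j' : Fin (n k')) (i' : Fin N)
    (_ : k' < k ∨ (k' = k ∧ (j' : ℕ) < j) ∨ (k' = k ∧ (j' : ℕ) = j ∧ (i' : ℕ) < i)),
    MeasurableSpace.comap (lam k' j' i') ⊤

variable {lam x}

lemma history_le {mΩ : MeasurableSpace Ω} (hlam : ∀ k j i, Measurable (lam k j i))
    (hx : ∀ k, Measurable[_, ⊤] (x k)) (k j i : ℕ) : history lam x k j i ≤ mΩ := by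
  refine sup_le (iSup₂_le fun l _ => (hx l).comap_le) ?_
  exact iSup₂_le fun k' j' => iSup₂_le fun i' _ => (hlam k' j' i').comap_le

lemma history_le_history {k j i j₂ i₂ : ℕ} (h : j < j₂ ∨ (j = j₂ ∧ i ≤ i₂)) :
    history lam x k j i ≤ history lam x k j₂ i₂ := by
  refine sup_le_sup le_rfl ?_
  refine iSup_mono fun k' => iSup_mono fun j' => iSup_mono fun i' => ?_
  exact iSup_mono' fun h' => ⟨by omega, le_rfl⟩

lemma measurable_iterate_history (k j i : ℕ) : Measurable[history lam x k j i, ⊤] (x k) := by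
  rw [measurable_iff_comap_le]
  exact le_sup_of_le_left (le_iSup₂_of_le k le_rfl le_rfl)

lemma measurable_comp_iterate_history {α : Type*} [MeasurableSpace α] (φ : (∀ i, X i) → α)
    (k j i : ℕ) : Measurable[history lam x k j i] fun ω => φ (x k ω) :=
  (@measurable_from_top _ _ _ φ).comp (measurable_iterate_history k j i)

lemma measurable_lam_history (k : ℕ) (j : Fin (n k)) (i : Fin N) {j₂ i₂ : ℕ}
    (h : (j : ℕ) < j₂ ∨ ((j : ℕ) = j₂ ∧ (i : ℕ) < i₂)) :
    Measurable[history lam x k j₂ i₂] (lam k j i) := by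
  rw [measurable_iff_comap_le]
  exact le_sup_of_le_right (le_iSup₂_of_le k j (le_iSup₂_of_le i (by tauto) le_rfl))

end History

variable {N M : ℕ} {X : Fin N → Type u} {E : Fin M → Type v}
  [∀ j, NormedAddCommGroup (E j)] [∀ j, InnerProductSpace ℝ (E j)] [∀ j, CompleteSpace (E j)]
  {P : Problem X E} {L Lt : Fin M → NNReal} {S : ∀ i, PiLp 2 E → X i}
  {Ω : Type w} [MeasurableSpace Ω] {Pr : Measure Ω} {n : ℕ → ℕ} {om : ℕ → unitInterval}
  {lam : ∀ k : ℕ, Fin (n k) → Fin N → Ω → Bool} {x : ℕ → Ω → ∀ i, X i} {x0 : ∀ i, X i}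

/-- The mean of `J` at a candidate constructed from the profile `z` with step size `p`. -/
def meanCandidate (P : Problem X E) (S : ∀ i, PiLp 2 E → X i) (p : ℝ) (z : ∀ i, X i) : ℝ :=
  bernoulliMean p fun b => P.J (switch z (fun i => S i (P.G z)) b)

lemma IsSFW.lintegral_mul_exp_candidate_le (hx : P.IsSFW Pr S x0 om lam x) (hreg : P.Regular L Lt)
    (k : ℕ) (j : Fin (n k)) {U : Ω → ENNReal} (hU : Measurable[history lam x k j 0] U) {t : ℝ}
    (ht : (om k : ℝ) * (1 - om k) = 0 ∨ |t| * (P.C0 L / N) ≤ 1) :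
    ∫⁻ ω, U ω * ENNReal.ofReal (Real.exp (t * P.J (P.candidate S lam x k j ω))) ∂Pr ≤
      ∫⁻ ω, U ω * ENNReal.ofReal (Real.exp (t * meanCandidate P S (om k) (x k ω) +
        N * (om k * (1 - om k) * (t * (P.C0 L / N)) ^ 2))) ∂Pr := by
  refine lintegral_mul_exp_le_bernoulliMean (fun i => history lam x k j i)
    (fun i => history_le hx.measurable_lam hx.measurable_x _ _ _)
    (fun i i' h => history_le_history (Or.inr ⟨rfl, h⟩)) (l := lam k j)
    (fun i => measurable_lam_history _ _ _ (Or.inr ⟨rfl, Nat.lt_succ_self _⟩))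
    -- At indices coming from `Fin`, `past` and `history` agree definitionally.
    (fun i => hx.bernoulli k j i) (fun i => hx.indep k j i)
    (F := fun ω b => P.J (switch (x k ω) (fun i => S i (P.G (x k ω))) b)) hU (fun b => ?_) ?_ ht
  · exact measurable_comp_iterate_history
      (fun z => P.J (switch z (fun i => S i (P.G z)) b)) k j 0
  · intro ω i b b' h
    exact hreg.abs_J_sub_le i fun i' hi' => by simp only [switch, h i' hi']

/-- The last candidate is integrated out with the earlier ones in the weight. The factor it leaves
depends only on `x k`, so it joins the weight when the induction hypothesis is applied. -/
lemma IsSFW.lintegral_mul_exp_sum_le (hx : P.IsSFW Pr S x0 om lam x) (hreg : P.Regular L Lt)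
    (k r : ℕ) (hr : r ≤ n k) {U : Ω → ENNReal} (hU : Measurable[history lam x k 0 0] U) {t : ℝ}
    (ht : (om k : ℝ) * (1 - om k) = 0 ∨ |t| * (P.C0 L / N) ≤ 1) :
    ∫⁻ ω, U ω * ENNReal.ofReal
        (Real.exp (t * ∑ j : Fin r, P.J (P.candidate S lam x k (Fin.castLE hr j) ω))) ∂Pr ≤
      ∫⁻ ω, U ω * ENNReal.ofReal (Real.exp (r * (t * meanCandidate P S (om k) (x k ω) +
        N * (om k * (1 - om k) * (t * (P.C0 L / N)) ^ 2)))) ∂Pr := by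
  induction r generalizing U with
  | zero => simp
  | succ r ih =>
    have hcand : ∀ j : Fin r, Measurable[history lam x k r 0]
        fun ω => P.J (P.candidate S lam x k (Fin.castLE hr j.castSucc) ω) := by
      exact fun j => measurable_eval_bool (m := history lam x k r 0)
        (F := fun ω b => P.J (switch (x k ω) (fun i => S i (P.G (x k ω))) b))
        (fun i => measurable_lam_history _ _ _ (Or.inl (by simp)))
        fun b => measurable_comp_iterate_history
          (fun z => P.J (switch z (fun i => S i (P.G z)) b)) k r 0
    set v : ℝ := N * (om k * (1 - om k) * (t * (P.C0 L / N)) ^ 2) with hv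
    have hmean : Measurable[history lam x k 0 0] fun ω =>
        ENNReal.ofReal (Real.exp (t * meanCandidate P S (om k) (x k ω) + v)) :=
      measurable_comp_iterate_history
        (fun z => ENNReal.ofReal (Real.exp (t * meanCandidate P S (om k) z + v))) k 0 0
    have h1 := hx.lintegral_mul_exp_candidate_le hreg k (Fin.castLE hr (Fin.last r)) (t := t)
      (U := fun ω => U ω * ENNReal.ofReal (Real.exp (t * ∑ j : Fin r,
        P.J (P.candidate S lam x k (Fin.castLE hr j.castSucc) ω))))
      ((hU.mono (history_le_history (by omega)) le_rfl).mul
        (Measurable.ennreal_ofReal (Real.measurable_exp.comp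
          ((Finset.measurable_fun_sum _ fun j _ => hcand j).const_mul t)))) ht
    have h2 := ih (Nat.le_of_succ_le hr) (hU.mul hmean)
    calc _ = _ := ?_
      _ ≤ _ := h1
      _ = _ := ?_
      _ ≤ _ := h2
      _ = _ := ?_
    · congr 1 with ω
      rw [Fin.sum_univ_castSucc, mul_add, Real.exp_add, ENNReal.ofReal_mul (Real.exp_pos _).le,
        mul_assoc]
    · congr 1 with ω
      exact mul_right_comm _ _ _
    · congr 1 with ω
      rw [Pi.mul_apply, mul_assoc, ← ENNReal.ofReal_mul (Real.exp_pos _).le, ← Real.exp_add]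
      congr 3
      push_cast
      ring

/-- The minimum over candidates is replaced by their average, so each candidate gets exponent `a / n
k`; summing `n k` quadratic terms then leaves a single factor `1 / n k`. -/
lemma IsSFW.lintegral_exp_succ_le (hx : P.IsSFW Pr S x0 om lam x) (hreg : P.Regular L Lt)
    (hconv : P.ConvexLSC) (hS : P.IsBestResponse S) (k : ℕ) (hn : 1 ≤ n k) {a : ℝ} (ha : 0 ≤ a)
    (ht : (om k : ℝ) * (1 - om k) = 0 ∨ a / n k * (P.C0 L / N) ≤ 1) :
    ∫⁻ ω, ENNReal.ofReal (Real.exp (a * (P.J (x (k + 1) ω) - P.relaxedValue))) ∂Pr ≤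
      ENNReal.ofReal (Real.exp (a * (om k ^ 2 * P.C1 Lt / 2 +
        om k * (1 - om k) * P.C1 Lt / (2 * N)) +
        N * (om k * (1 - om k) * (a * (P.C0 L / N)) ^ 2) / n k)) *
      ∫⁻ ω, ENNReal.ofReal (Real.exp (a * (1 - om k) * (P.J (x k ω) - P.relaxedValue))) ∂Pr := by
  have hn0 : (0 : ℝ) < n k := by exact_mod_cast hn
  have h := hx.lintegral_mul_exp_sum_le hreg k (n k) le_rfl
    (U := fun _ => ENNReal.ofReal (Real.exp (-(a * P.relaxedValue)))) measurable_const
    (t := a / n k) (by rwa [abs_of_nonneg (by positivity)])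
  rw [← lintegral_const_mul' _ _ ENNReal.ofReal_ne_top]
  refine le_trans (le_trans (lintegral_mono fun ω => ?_) h) (lintegral_mono fun ω => ?_)
  · dsimp only
    rw [← ENNReal.ofReal_mul (Real.exp_pos _).le, ← Real.exp_add]
    refine ENNReal.ofReal_le_ofReal (Real.exp_le_exp.2 ?_)
    have : (n k : ℝ) * P.J (x (k + 1) ω) ≤
        ∑ j : Fin (n k), P.J (P.candidate S lam x k (Fin.castLE le_rfl j) ω) := by
      have := Finset.card_nsmul_le_sum (Finset.univ : Finset (Fin (n k)))
        (fun j => P.J (P.candidate S lam x k (Fin.castLE le_rfl j) ω)) (P.J (x (k + 1) ω))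
        fun j _ => hx.argmin k ω _
      simpa using this
    have h2 := mul_le_mul_of_nonneg_left this (show 0 ≤ a / n k by positivity)
    rw [← mul_assoc, div_mul_cancel₀ _ hn0.ne'] at h2
    linarith
  · dsimp only
    rw [← ENNReal.ofReal_mul (Real.exp_pos _).le, ← Real.exp_add,
      ← ENNReal.ofReal_mul (Real.exp_pos _).le, ← Real.exp_add]
    refine ENNReal.ofReal_le_ofReal (Real.exp_le_exp.2 ?_)
    have hm := mul_le_mul_of_nonneg_left (hreg.bernoulliMean_J_switch_bestResponse_le hconv hS
      (om k).2.1 (om k).2.2 (x k ω)) ha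
    have e : (n k : ℝ) * (a / n k * meanCandidate P S (om k) (x k ω) +
        N * (om k * (1 - om k) * (a / n k * (P.C0 L / N)) ^ 2)) =
        a * meanCandidate P S (om k) (x k ω) +
        N * (om k * (1 - om k) * (a * (P.C0 L / N)) ^ 2) / n k := by
      field_simp
    rw [e, meanCandidate]
    linarith

end Problem

/-! ### Recursion for the weighted gap -/

namespace Problem

universe u v w

variable {N M : ℕ} {X : Fin N → Type u} {E : Fin M → Type v}
  [∀ j, NormedAddCommGroup (E j)] [∀ j, InnerProductSpace ℝ (E j)] [∀ j, CompleteSpace (E j)]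
  {P : Problem X E} {L Lt : Fin M → NNReal} {S : ∀ i, PiLp 2 E → X i}
  {Ω : Type w} [MeasurableSpace Ω] {Pr : Measure Ω} {n : ℕ → ℕ} {om : ℕ → unitInterval}
  {lam : ∀ k : ℕ, Fin (n k) → Fin N → Ω → Bool} {x : ℕ → Ω → ∀ i, X i} {x0 : ∀ i, X i}

/-- Bound on the exponential moment of `k (k + 1) γ_k` for the step sizes `2 / (k + 2)`. -/
lemma IsSFW.lintegral_exp_gap_le [IsProbabilityMeasure Pr] (hx : P.IsSFW Pr S x0 om lam x)
    (hreg : P.Regular L Lt) (hconv : P.ConvexLSC) (hS : P.IsBestResponse S) (hN : 1 ≤ N)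
    {A : ℝ} (hA : 0 < A) (hom : ∀ k : ℕ, (om k : ℝ) = 2 / ((k : ℝ) + 2))
    (hn : ∀ k : ℕ, max (A * (k : ℝ) ^ 2 / (N : ℝ)) 1 ≤ (n k : ℝ)) {s : ℝ} (hs : 0 ≤ s) (k : ℕ)
    (hsA : 2 ≤ k → 6 * (s * P.C0 L) ≤ A) :
    ∫⁻ ω, ENNReal.ofReal
        (Real.exp (s * (k * (k + 1)) * (P.J (x k ω) - P.relaxedValue))) ∂Pr ≤
      ENNReal.ofReal (Real.exp (s * P.C1 Lt * (2 * k + k * (k - 1) / (2 * N)) +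
        k * (k + 5) * ((s * P.C0 L) ^ 2 / A))) := by
  have hN0 : (0 : ℝ) < N := by exact_mod_cast hN
  have hC0 := P.C0_nonneg L
  have hC1 := P.C1_nonneg Lt
  induction k with
  | zero => simp
  | succ k ih =>
    have hn1 : (1 : ℝ) ≤ n k := (le_max_right _ _).trans (hn k)
    have hnA : A * (k : ℝ) ^ 2 ≤ N * n k := by
      have := (le_max_left _ _).trans (hn k)
      rwa [div_le_iff₀ hN0, mul_comm (n k : ℝ)] at this
    have hn0 : (0 : ℝ) < n k := by linarith
    have hk0 : (0 : ℝ) ≤ k := k.cast_nonneg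
    have hp1 : 1 - (om k : ℝ) = k / (k + 2) := by rw [hom]; field_simp; ring
    have hstep := hx.lintegral_exp_succ_le hreg hconv hS k (by exact_mod_cast hn1)
      (a := s * ((k + 1) * (k + 2))) (by positivity) (by
        rcases Nat.eq_zero_or_pos k with rfl | hk
        -- The first step size is `1`, so the first iteration is deterministic; no smallness of the
        -- exponent is available or needed there.
        · left; rw [hp1]; simp
        · right
          have hk1 : (1 : ℝ) ≤ k := by exact_mod_cast hk
          have h6 := hsA (by omega)
          rw [div_mul_div_comm, div_le_one (by positivity)]
          calc s * ((k + 1) * (k + 2)) * P.C0 L = s * P.C0 L * ((k + 1) * (k + 2)) := by ring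
            -- The constant `6` is sharp: `(k + 1) (k + 2) ≤ 6 k ^ 2` for `k ≥ 1`, with equality at
            -- `k = 1`.
            _ ≤ s * P.C0 L * (6 * (k : ℝ) ^ 2) :=
              mul_le_mul_of_nonneg_left (by nlinarith) (mul_nonneg hs hC0)
            _ = 6 * (s * P.C0 L) * (k : ℝ) ^ 2 := by ring
            _ ≤ A * (k : ℝ) ^ 2 := by gcongr
            _ ≤ n k * N := by linarith)
    have e : s * ((k + 1) * (k + 2)) * (1 - (om k : ℝ)) = s * (k * (k + 1)) := by
      rw [hp1]; field_simp
    rw [e] at hstep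
    have ih' := ih fun h => hsA (by omega)
    push_cast
    rw [show (k : ℝ) + 1 + 1 = k + 2 by ring]
    refine hstep.trans ((mul_le_mul_right ih' _).trans ?_)
    rw [← ENNReal.ofReal_mul (Real.exp_pos _).le, ← Real.exp_add]
    refine ENNReal.ofReal_le_ofReal (Real.exp_le_exp.2 ?_)
    have h1 : s * ((k + 1) * (k + 2)) * ((om k : ℝ) ^ 2 * P.C1 Lt / 2 +
        om k * (1 - om k) * P.C1 Lt / (2 * N)) ≤ s * P.C1 Lt * (2 + k / N) := by
      rw [hp1, hom]
      have : s * ((k + 1) * (k + 2)) * ((2 / ((k : ℝ) + 2)) ^ 2 * P.C1 Lt / 2 +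
          2 / ((k : ℝ) + 2) * (k / (k + 2)) * P.C1 Lt / (2 * N)) =
          s * P.C1 Lt * (2 + k / N) * ((k + 1) / (k + 2)) := by
        field_simp
      rw [this]
      refine mul_le_of_le_one_right (by positivity) ?_
      rw [div_le_one (by positivity)]
      linarith
    have h2 : (N : ℝ) * (om k * (1 - om k) * (s * ((k + 1) * (k + 2)) * (P.C0 L / N)) ^ 2) / n k ≤
        (2 * k + 6) * ((s * P.C0 L) ^ 2 / A) := by
      rw [hp1, hom]
      rcases Nat.eq_zero_or_pos k with rfl | hk
      · simp; positivity
      have hk1 : (1 : ℝ) ≤ k := by exact_mod_cast hk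
      calc _ = 2 * k * ((k : ℝ) + 1) ^ 2 * (s * P.C0 L) ^ 2 / (N * n k) := by field_simp
        _ ≤ 2 * k * ((k : ℝ) + 1) ^ 2 * (s * P.C0 L) ^ 2 / (A * k ^ 2) := by gcongr
        _ = (2 * ((k : ℝ) + 1) ^ 2 / k) * ((s * P.C0 L) ^ 2 / A) := by field_simp
        -- `2 (k + 1) ^ 2 / k = 2 k + 4 + 2 / k ≤ 2 k + 6`; these increments sum to the `k (k + 5)`
        -- of the statement.
        _ ≤ _ := by
          gcongr
          rw [div_le_iff₀ (by positivity)]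
          nlinarith
    have h3 : s * P.C1 Lt * (2 + k / N) + s * P.C1 Lt * (2 * k + k * (k - 1) / (2 * N)) =
        s * P.C1 Lt * (2 * (k + 1) + (k + 1) * (k + 1 - 1) / (2 * N)) := by
      field_simp
      ring
    linarith

end Problem

/-! ### Choice of the exponent and conclusion -/

/-- Choice of the exponent in the Chernoff bound. -/
lemma exists_chernoff_exponent {C₀ C₁ A N K : ℝ} (hC₀ : 0 ≤ C₀) (hC₁ : 0 ≤ C₁)
    (hC : 0 < C₀ ∨ 0 < C₁) (hA : 0 < A) (hN : 0 < N) (hK1 : 1 ≤ K) (hK : K ≤ 2 * N) :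
    ∃ s : ℝ, 0 ≤ s ∧ (2 ≤ K → 6 * (s * C₀) ≤ A) ∧
      s * C₁ * (2 * K + K * (K - 1) / (2 * N)) + K * (K + 5) * ((s * C₀) ^ 2 / A) + A / 12 ≤
        s * (K * (K + 1)) * ((4 * C₁ + C₀) / K) := by
  -- The restriction `K ≤ 2 N` enters here: it keeps the accumulated sampling bias linear in `K`.
  have hlin : K * (K - 1) / (2 * N) ≤ K - 1 := by
    rw [div_le_iff₀ (by positivity)]
    nlinarith
  have hrhs : ∀ s : ℝ, s * (K * (K + 1)) * ((4 * C₁ + C₀) / K) =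
      s * C₁ * (4 * (K + 1)) + s * C₀ * (K + 1) := fun s => by
    field_simp
  have hbound : ∀ s : ℝ, 0 ≤ s → s * C₁ * (2 * K + K * (K - 1) / (2 * N)) ≤ s * C₁ * (3 * K) :=
    fun s hs => by gcongr; linarith
  rcases hC₀.eq_or_lt with h0 | h0
  · have h1 : 0 < C₁ := hC.resolve_left (by rw [← h0]; exact lt_irrefl 0)
    -- Without the `C₀` terms any large exponent works; the spare `s C₁ (K + 4)` only has to cover
    -- `A / 12`.
    refine ⟨A / C₁, by positivity, fun _ => by rw [← h0]; simpa using hA.le, ?_⟩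
    have := hbound (A / C₁) (by positivity)
    rw [hrhs, ← h0]
    rw [div_mul_cancel₀ _ h1.ne'] at this ⊢
    simp only [mul_zero, zero_mul, add_zero, ne_eq, OfNat.ofNat_ne_zero, not_false_eq_true,
      zero_pow, zero_div]
    nlinarith
  -- This choice makes the linear gain `s C₀ (K + 1)` equal to `A / 4`, while the quadratic loss is
  -- at most `A / 8`; the remaining `A / 8` covers `A / 12`.
  · refine ⟨A / (4 * C₀ * (K + 1)), by positivity, ?_, ?_⟩
    all_goals
      have e : A / (4 * C₀ * (K + 1)) * C₀ = A / (4 * (K + 1)) := by field_simp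
    · intro h2
      rw [e, ← mul_div_assoc, div_le_iff₀ (by positivity)]
      nlinarith
    · have := hbound (A / (4 * C₀ * (K + 1))) (by positivity)
      have hs1 : 0 ≤ A / (4 * C₀ * (K + 1)) * C₁ := by positivity
      rw [hrhs, e]
      have e2 : A / (4 * (K + 1)) * (K + 1) = A / 4 := by field_simp
      have e3 : K * (K + 5) * ((A / (4 * (K + 1))) ^ 2 / A) ≤ A / 8 := by
        have : K * (K + 5) * ((A / (4 * (K + 1))) ^ 2 / A) =
            A * (K * (K + 5)) / (16 * (K + 1) ^ 2) := by field_simp; norm_num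
        rw [this, div_le_iff₀ (by positivity)]
        -- The slack is `2 (K + 1) ^ 2 - K (K + 5) = K ^ 2 - K + 2`.
        nlinarith [mul_nonneg hA.le (show 0 ≤ K ^ 2 - K + 2 by nlinarith)]
      rw [e2]
      nlinarith

end Aggregative

end

theorem corollary3p6 {N M : ℕ} {X : Fin N → Type*} {E : Fin M → Type*}
    [∀ j, NormedAddCommGroup (E j)] [∀ j, InnerProductSpace ℝ (E j)]
    [∀ j, CompleteSpace (E j)] [∀ j, TopologicalSpace.SeparableSpace (E j)]
    (P : Aggregative.Problem X E) (L Lt : Fin M → NNReal)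
    (hreg : P.Regular L Lt) (hconv : P.ConvexLSC)
    (S : ∀ i, PiLp 2 E → X i) (hS : P.IsBestResponse S)
    (hC : 0 < P.C0 L ∨ 0 < P.C1 Lt)
    {Ω : Type*} [MeasurableSpace Ω] (Pr : MeasureTheory.Measure Ω)
    [MeasureTheory.IsProbabilityMeasure Pr]
    (A : ℝ) (hA : 0 < A)
    (om : ℕ → unitInterval) (hom : ∀ k : ℕ, (om k : ℝ) = 2 / ((k : ℝ) + 2))
    (n : ℕ → ℕ) (hn : ∀ k : ℕ, max (A * (k : ℝ) ^ 2 / (N : ℝ)) 1 ≤ (n k : ℝ))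
    (x0 : ∀ i, X i) (lam : ∀ k : ℕ, Fin (n k) → Fin N → Ω → Bool)
    (x : ℕ → Ω → ∀ i, X i) (hx : P.IsSFW Pr S x0 om lam x)
    (K : ℕ) (hK1 : 1 ≤ K) (hK : K ≤ 2 * N) :
    1 - Real.exp (-A / 12) ≤
      Pr.real {ω | P.J (x K ω) - P.relaxedValue < (4 * P.C1 Lt + P.C0 L) / (K : ℝ)} := by
  have hN : 1 ≤ N := by omega
  have hK1' : (1 : ℝ) ≤ K := by exact_mod_cast hK1
  obtain ⟨s, hs, hsA, hfin⟩ := Aggregative.exists_chernoff_exponent (P.C0_nonneg L)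
    (P.C1_nonneg Lt) hC hA (N := N) (K := K) (by exact_mod_cast hN) hK1' (by exact_mod_cast hK)
  have hmom := hx.lintegral_exp_gap_le hreg hconv hS hN hA hom hn hs K
    fun h => hsA (by exact_mod_cast h)
  set τ : ℝ := (4 * P.C1 Lt + P.C0 L) / K with hτ
  set γ : Ω → ℝ := fun ω => P.J (x K ω) - P.relaxedValue with hγ
  have hγm : Measurable γ :=
    (@measurable_from_top _ _ _ fun z => P.J z - P.relaxedValue).comp (hx.measurable_x K)
  have hw : 0 ≤ s * ((K : ℝ) * (K + 1)) := by positivity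
  have hmarkov := MeasureTheory.mul_meas_ge_le_lintegral₀ (μ := Pr)
    (f := fun ω => ENNReal.ofReal (Real.exp (s * ((K : ℝ) * (K + 1)) * γ ω)))
    (Measurable.ennreal_ofReal (Real.measurable_exp.comp (hγm.const_mul _))).aemeasurable
    (ENNReal.ofReal (Real.exp (s * ((K : ℝ) * (K + 1)) * τ)))
  have hle : ENNReal.ofReal (Real.exp (s * ((K : ℝ) * (K + 1)) * τ)) * Pr {ω | τ ≤ γ ω} ≤
      ENNReal.ofReal (Real.exp (s * P.C1 Lt * (2 * K + K * (K - 1) / (2 * N)) +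
        K * (K + 5) * ((s * P.C0 L) ^ 2 / A))) := by
    refine le_trans ?_ (hmarkov.trans hmom)
    refine mul_le_mul' le_rfl (MeasureTheory.measure_mono fun ω hω => ?_)
    exact ENNReal.ofReal_le_ofReal (Real.exp_le_exp.2 (mul_le_mul_of_nonneg_left hω hw))
  have htail : Pr.real {ω | τ ≤ γ ω} ≤ Real.exp (-A / 12) := by
    have h := ENNReal.toReal_mono ENNReal.ofReal_ne_top hle
    rw [ENNReal.toReal_mul, ENNReal.toReal_ofReal (Real.exp_pos _).le,
      ENNReal.toReal_ofReal (Real.exp_pos _).le, mul_comm, ← le_div_iff₀ (Real.exp_pos _),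
      ← Real.exp_sub] at h
    refine h.trans (Real.exp_le_exp.2 ?_)
    linarith
  have hcompl : {ω | γ ω < τ} = {ω | τ ≤ γ ω}ᶜ := by
    ext ω
    simp
  change _ ≤ Pr.real {ω | γ ω < τ}
  rw [hcompl, MeasureTheory.probReal_compl_eq_one_sub (measurableSet_le measurable_const hγm)]
  linarith
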